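/- Let $d\ge 1$ be an integer. There is a constant $C>0$ depending only on $d$ such that the following holds. Let $\Phi\in C^\infty(\mathbf R^d)$ be real valued, let $b\in C_0^\infty(\mathbf R^d)$ be complex valued with support $K=\operatorname{supp} b$, let $V$ be an open neighbourhood of $K$, and let $a_0>0$. For $k\ge 2$ and $l\ge 0$ put $$\mathcal M_k=\sum_{2\le|\alpha|\le k}\ \sup_{\xi\in V}|D^\alpha_\xi\Phi(\xi)|,\qquad \mathcal N_l=\sum_{|\alpha|\le l}\ \sup_{\xi\in K}|D_\xi^\alpha b(\xi)| .$$ Assume that (i) $\mathcal M_k<+\infty$ for $2\le k\le d+2$; (ii) $\mathcal N_l<+\infty$ for $l\le d+1$; (iii) $|\det \operatorname{Hess}\Phi(\xi)|\ge a_0$ for all $\xi\in V$, where $\operatorname{Hess}\Phi$ is the Hessian matrix of $\Phi$; (iv) the map $V\to\mathbf R^d$, $\xi\mapsto\nabla\Phi(\xi)$, is injective. Then for all $\lambda\ge 1$ the integral $I(\lambda)=\int_{\mathbf R^d}e^{i\lambda\Phi(\xi)}b(\xi)\,d\xi$ satisfies $$|I(\lambda)|\le \frac{C}{a_0}\,\bigl(1+\mathcal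 M_{d+2}^{d/2}\bigr)\,\mathcal N_{d+1}\,\lambda^{-d/2}.$$ -/

import Mathlib

open MeasureTheory
open scoped ENNReal ContDiff

noncomputable section

/-- The partial derivative `∂ᵢ f` of a function on `ℝ^d`. -/
def partialDeriv {d : ℕ} {F : Type*} [NormedAddCommGroup F] [NormedSpace ℝ F]
    (i : Fin d) (f : EuclideanSpace ℝ (Fin d) → F) : EuclideanSpace ℝ (Fin d) → F :=
  fun ξ => fderiv ℝ f ξ (EuclideanSpace.single i 1)

/-- The derivative `D^α f = ∂₁^{α₁} ⋯ ∂_d^{α_d} f` for a multi-index `α`. -/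
def multiDeriv {d : ℕ} {F : Type*} [NormedAddCommGroup F] [NormedSpace ℝ F]
    (α : Fin d → ℕ) (f : EuclideanSpace ℝ (Fin d) → F) : EuclideanSpace ℝ (Fin d) → F :=
  (List.finRange d).foldr (fun i g => (partialDeriv i)^[α i] g) f

/-- The finite set of multi-indices `α ∈ ℕ^d` of length `|α| = α₁ + ⋯ + α_d = j`. -/
def multiIndices (d j : ℕ) : Finset (Fin d → ℕ) :=
  Finset.piAntidiag Finset.univ j

/-- `𝓜_k = ∑_{2 ≤ |α| ≤ k} sup_{ξ ∈ V} |D^α Φ(ξ)|`, with values in `[0, ∞]`. -/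
def phaseNorm {d : ℕ} (Φ : EuclideanSpace ℝ (Fin d) → ℝ) (V : Set (EuclideanSpace ℝ (Fin d)))
    (k : ℕ) : ℝ≥0∞ :=
  ∑ j ∈ Finset.Icc 2 k, ∑ α ∈ multiIndices d j, ⨆ ξ ∈ V, ‖multiDeriv α Φ ξ‖ₑ

/-- `𝓝_l = ∑_{|α| ≤ l} sup_{ξ ∈ supp b} |D^α b(ξ)|`, with values in `[0, ∞]`. -/
def symbolNorm {d : ℕ} (b : EuclideanSpace ℝ (Fin d) → ℂ) (l : ℕ) : ℝ≥0∞ :=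
  ∑ j ∈ Finset.Icc 0 l, ∑ α ∈ multiIndices d j, ⨆ ξ ∈ tsupport b, ‖multiDeriv α b ξ‖ₑ

/-- The Hessian matrix `(∂ᵢ ∂ⱼ Φ(ξ))ᵢⱼ`. -/
def hessianMatrix {d : ℕ} (Φ : EuclideanSpace ℝ (Fin d) → ℝ) (ξ : EuclideanSpace ℝ (Fin d)) :
    Matrix (Fin d) (Fin d) ℝ :=
  Matrix.of fun i j => partialDeriv i (partialDeriv j Φ) ξ

/-- The oscillatory integral `I(λ) = ∫ e^{iλΦ(ξ)} b(ξ) dξ` over `ℝ^d`. -/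
def oscillatoryIntegral {d : ℕ} (Φ : EuclideanSpace ℝ (Fin d) → ℝ)
    (b : EuclideanSpace ℝ (Fin d) → ℂ) (lam : ℝ) : ℂ :=
  ∫ ξ : EuclideanSpace ℝ (Fin d), Complex.exp (Complex.I * (lam : ℂ) * (Φ ξ : ℂ)) * b ξ

end

/-! Put M = max(1, 𝓜_{d+2}), σ = (λ/M)^{1/2}, ε = (λM)^{-1/2}, e = e^{iλΦ} and g = σ∇Φ. Then ε∂ⱼe =
i gⱼ e, so the operator (1 + |g|²)⁻¹(1 - iε g·∂) fixes e, while ε∂ⱼgₖ = M⁻¹∂ⱼ∂ₖΦ is bounded by 1 on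
V together with its derivatives up to order d. Hence each transposition of the operator onto the
amplitude uses one derivative, costs a dimensional constant and gains a factor (1 + |g|²)^{-1/2}
(`exists_norm_integral_le_integral_fieldWeight`).

After d+1 transpositions the integrand is O(𝓝_{d+1} (1 + σ²|∇Φ|²)^{-(d+1)/2}). No critical point has
to be located: ξ ↦ ∇Φ(ξ) is injective with Jacobian at least a₀ in modulus, and (1 +
σ²|η|²)^{-(d+1)/2} is integrable on ℝ^d with integral a multiple of σ^{-d}
(`exists_setIntegral_fieldWeight_le`). Finally σ^{-d} = M^{d/2}λ^{-d/2} and M^{d/2} ≤ 1 +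
𝓜_{d+2}^{d/2}. -/

/-! ### Calculus of iterated partial derivatives. -/

section PartialDerivatives

variable {d : ℕ} {F : Type*} [NormedAddCommGroup F] [NormedSpace ℝ F]

theorem contDiff_partialDeriv {f : EuclideanSpace ℝ (Fin d) → F} (hf : ContDiff ℝ ∞ f)
    (i : Fin d) : ContDiff ℝ ∞ (partialDeriv i f) := by
  have h : ContDiff ℝ ∞ (fderiv ℝ f) := hf.fderiv_right (by simp)
  exact h.clm_apply contDiff_const

theorem partialDeriv_comm {f : EuclideanSpace ℝ (Fin d) → F} (hf : ContDiff ℝ ∞ f)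
    (i j : Fin d) : partialDeriv i (partialDeriv j f) = partialDeriv j (partialDeriv i f) := by
  have h : Differentiable ℝ (fderiv ℝ f) :=
    (hf.fderiv_right (m := ∞) (by simp)).differentiable (by simp)
  have key : ∀ (i j : Fin d) (x : EuclideanSpace ℝ (Fin d)),
      partialDeriv i (partialDeriv j f) x =
        fderiv ℝ (fderiv ℝ f) x (EuclideanSpace.single i 1) (EuclideanSpace.single j 1) := by
    intro i j x
    have := ((h x).hasFDerivAt.clm_apply
      (hasFDerivAt_const (EuclideanSpace.single j (1 : ℝ)) x)).fderiv
    change fderiv ℝ (fun y => fderiv ℝ f y (EuclideanSpace.single j 1)) x _ = _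
    rw [this]
    simp
  funext x
  rw [key, key]
  exact (hf.contDiffAt.isSymmSndFDerivAt (by
    rw [minSmoothness_of_isRCLikeNormedField]; exact WithTop.coe_le_coe.2 (OrderTop.le_top 2))) _ _

theorem contDiff_iterate_partialDeriv {f : EuclideanSpace ℝ (Fin d) → F} (hf : ContDiff ℝ ∞ f)
    (i : Fin d) (n : ℕ) : ContDiff ℝ ∞ ((partialDeriv i)^[n] f) := by
  induction n with
  | zero => exact hf
  | succ n ih =>
    rw [Function.iterate_succ_apply']
    exact contDiff_partialDeriv ih i

theorem partialDeriv_iterate_comm {f : EuclideanSpace ℝ (Fin d) → F} (hf : ContDiff ℝ ∞ f)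
    (i j : Fin d) (n : ℕ) :
    partialDeriv i ((partialDeriv j)^[n] f) = (partialDeriv j)^[n] (partialDeriv i f) := by
  induction n with
  | zero => rfl
  | succ n ih =>
    rw [Function.iterate_succ_apply', Function.iterate_succ_apply',
      partialDeriv_comm (contDiff_iterate_partialDeriv hf j n), ih]

theorem contDiff_foldr_iterate_partialDeriv {f : EuclideanSpace ℝ (Fin d) → F}
    (hf : ContDiff ℝ ∞ f) (α : Fin d → ℕ) (L : List (Fin d)) :
    ContDiff ℝ ∞ (L.foldr (fun i g => (partialDeriv i)^[α i] g) f) := by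
  induction L with
  | nil => exact hf
  | cons j L ih => exact contDiff_iterate_partialDeriv ih j _

/-- By symmetry of second derivatives, ∂ᵢ moves past the blocks of other indices until it joins the
block of i, which occurs once since `L` has no duplicates. -/
theorem partialDeriv_foldr_iterate {f : EuclideanSpace ℝ (Fin d) → F}
    (hf : ContDiff ℝ ∞ f) (α : Fin d → ℕ) (i : Fin d) (L : List (Fin d)) (hL : L.Nodup)
    (hi : i ∈ L) :
    partialDeriv i (L.foldr (fun i g => (partialDeriv i)^[α i] g) f) =
      L.foldr (fun k g => (partialDeriv k)^[(α + Pi.single i 1 : Fin d → ℕ) k] g) f := by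
  induction L with
  | nil => simp at hi
  | cons j L ih =>
    rw [List.nodup_cons] at hL
    rw [List.foldr_cons, List.foldr_cons]
    by_cases hij : i = j
    · subst hij
      have : L.foldr (fun k g => (partialDeriv k)^[(α + Pi.single i 1 : Fin d → ℕ) k] g) f =
          L.foldr (fun i g => (partialDeriv i)^[α i] g) f := by
        apply List.foldr_ext
        intro k hk g
        have : k ≠ i := fun h => hL.1 (h ▸ hk)
        simp [this]
      rw [this, Pi.add_apply, Pi.single_eq_same, Function.iterate_succ_apply']
    · rw [partialDeriv_iterate_comm (contDiff_foldr_iterate_partialDeriv hf α L),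
        ih hL.2 (by simpa [hij] using hi)]
      simp [Ne.symm hij]

/-- Any iterated partial derivative of a smooth function is some `D^α`. -/
theorem exists_foldr_partialDeriv_eq_multiDeriv {f : EuclideanSpace ℝ (Fin d) → F}
    (hf : ContDiff ℝ ∞ f) (l : List (Fin d)) :
    ∃ α ∈ multiIndices d l.length, l.foldr partialDeriv f = multiDeriv α f := by
  induction l with
  | nil =>
    refine ⟨0, by simp [multiIndices], ?_⟩
    unfold multiDeriv
    induction List.finRange d with
    | nil => rfl
    | cons j L ih => exact ih
  | cons i l ih =>
    obtain ⟨α, hα, h⟩ := ih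
    refine ⟨α + Pi.single i 1, ?_, ?_⟩
    · simp only [multiIndices, Finset.mem_piAntidiag] at hα ⊢
      simp [Finset.sum_add_distrib, hα.1]
    · rw [List.foldr_cons, h]
      exact partialDeriv_foldr_iterate hf α i _ (List.nodup_finRange d) (List.mem_finRange i)

theorem contDiff_smul_partialDeriv {f : EuclideanSpace ℝ (Fin d) → F} (hf : ContDiff ℝ ∞ f)
    (ε : ℝ) (i : Fin d) : ContDiff ℝ ∞ (fun x => ε • partialDeriv i f x) :=
  contDiff_const.smul (contDiff_partialDeriv hf i)

theorem partialDeriv_const_smul {𝕜 : Type*} [NormedField 𝕜] [NormedSpace 𝕜 F]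
    [SMulCommClass ℝ 𝕜 F] (c : 𝕜) {f : EuclideanSpace ℝ (Fin d) → F} (hf : ContDiff ℝ ∞ f)
    (i : Fin d) : partialDeriv i (fun x => c • f x) = fun x => c • partialDeriv i f x := by
  funext x
  unfold partialDeriv
  rw [fderiv_fun_const_smul (hf.differentiable (by simp) x)]
  rfl

theorem partialDeriv_smul {f : EuclideanSpace ℝ (Fin d) → ℝ} {u : EuclideanSpace ℝ (Fin d) → F}
    (hf : ContDiff ℝ ∞ f) (hu : ContDiff ℝ ∞ u) (i : Fin d) :
    partialDeriv i (fun x => f x • u x) =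
      fun x => partialDeriv i f x • u x + f x • partialDeriv i u x := by
  funext x
  unfold partialDeriv
  rw [fderiv_fun_smul (hf.differentiable (by simp) x) (hu.differentiable (by simp) x)]
  simp [add_comm]

theorem partialDeriv_add {u v : EuclideanSpace ℝ (Fin d) → F}
    (hu : ContDiff ℝ ∞ u) (hv : ContDiff ℝ ∞ v) (i : Fin d) :
    partialDeriv i (fun x => u x + v x) = fun x => partialDeriv i u x + partialDeriv i v x := by
  funext x
  unfold partialDeriv
  rw [fderiv_fun_add (hu.differentiable (by simp) x) (hv.differentiable (by simp) x)]
  rfl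

theorem foldr_partialDeriv_const_smul (c : ℝ) {f : EuclideanSpace ℝ (Fin d) → F}
    (hf : ContDiff ℝ ∞ f) (l : List (Fin d)) :
    ContDiff ℝ ∞ (l.foldr partialDeriv f) ∧
    l.foldr partialDeriv (fun x => c • f x) = fun x => c • l.foldr partialDeriv f x := by
  induction l with
  | nil => exact ⟨hf, rfl⟩
  | cons i l ih =>
    simp only [List.foldr_cons]
    rw [ih.2]
    exact ⟨contDiff_partialDeriv ih.1 i, partialDeriv_const_smul c ih.1 i⟩

theorem tsupport_partialDeriv_subset (f : EuclideanSpace ℝ (Fin d) → F) (i : Fin d) :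
    tsupport (partialDeriv i f) ⊆ tsupport f := by
  refine (closure_mono fun x hx => ?_).trans (tsupport_fderiv_subset (f := f) ℝ)
  exact fun h => hx (by simp [partialDeriv, h])

end PartialDerivatives

/-! ### Weighted bounds for derivatives at scale ε. -/

section DerivBound

variable {d : ℕ} {F : Type*} [NormedAddCommGroup F] [NormedSpace ℝ F]

/-- All derivatives `(ε∂)^α u` of order at most `n` are bounded by the weight `W` on `K`. -/
def DerivBound (ε : ℝ) (K : Set (EuclideanSpace ℝ (Fin d))) :
    ℕ → (EuclideanSpace ℝ (Fin d) → ℝ) → (EuclideanSpace ℝ (Fin d) → F) → Prop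
  | 0, W, u => ∀ x ∈ K, ‖u x‖ ≤ W x
  | n + 1, W, u => (∀ x ∈ K, ‖u x‖ ≤ W x) ∧
      ∀ j, DerivBound ε K n W (fun x => ε • partialDeriv j u x)

variable {ε : ℝ} {K : Set (EuclideanSpace ℝ (Fin d))} {n : ℕ}
  {W W' : EuclideanSpace ℝ (Fin d) → ℝ}

theorem DerivBound.norm_le {u : EuclideanSpace ℝ (Fin d) → F} (h : DerivBound ε K n W u) :
    ∀ x ∈ K, ‖u x‖ ≤ W x := by
  cases n with
  | zero => exact h
  | succ n => exact h.1

theorem DerivBound.mono {u : EuclideanSpace ℝ (Fin d) → F} (h : DerivBound ε K n W u)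
    (hW : ∀ x ∈ K, W x ≤ W' x) : DerivBound ε K n W' u := by
  induction n generalizing u with
  | zero => exact fun x hx => (h x hx).trans (hW x hx)
  | succ n ih => exact ⟨fun x hx => (h.1 x hx).trans (hW x hx), fun j => ih (h.2 j)⟩

theorem DerivBound.of_succ {u : EuclideanSpace ℝ (Fin d) → F} (h : DerivBound ε K (n + 1) W u) :
    DerivBound ε K n W u := by
  induction n generalizing u with
  | zero => exact h.1
  | succ n ih => exact ⟨h.1, fun j => ih (h.2 j)⟩

theorem DerivBound.of_le {m : ℕ} {u : EuclideanSpace ℝ (Fin d) → F} (h : DerivBound ε K m W u)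
    (hnm : n ≤ m) : DerivBound ε K n W u := by
  induction hnm with
  | refl => exact h
  | step _ ih => exact ih h.of_succ

theorem DerivBound.add {u v : EuclideanSpace ℝ (Fin d) → F}
    (hu : ContDiff ℝ ∞ u) (hv : ContDiff ℝ ∞ v)
    (h : DerivBound ε K n W u) (h' : DerivBound ε K n W' v) :
    DerivBound ε K n (fun x => W x + W' x) (fun x => u x + v x) := by
  have h0 : ∀ x ∈ K, ‖u x + v x‖ ≤ W x + W' x := fun x hx =>
    (norm_add_le _ _).trans (add_le_add (h.norm_le x hx) (h'.norm_le x hx))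
  induction n generalizing u v with
  | zero => exact h0
  | succ n ih =>
    refine ⟨h0, fun j => ?_⟩
    rw [partialDeriv_add hu hv]
    simp only [smul_add]
    have h1 := h.2 j
    have h2 := h'.2 j
    exact ih (contDiff_smul_partialDeriv hu ε j)
      (contDiff_smul_partialDeriv hv ε j) h1 h2 (fun x hx =>
        (norm_add_le _ _).trans (add_le_add (h1.norm_le x hx) (h2.norm_le x hx)))

theorem DerivBound.const_smul {𝕜 : Type*} [NormedField 𝕜] [NormedSpace 𝕜 F]
    [SMulCommClass ℝ 𝕜 F] (c : 𝕜) {u : EuclideanSpace ℝ (Fin d) → F} (hu : ContDiff ℝ ∞ u)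
    (h : DerivBound ε K n W u) :
    DerivBound ε K n (fun x => ‖c‖ * W x) (fun x => c • u x) := by
  have h0 : ∀ x ∈ K, ‖c • u x‖ ≤ ‖c‖ * W x := fun x hx => by
    rw [norm_smul]; exact mul_le_mul_of_nonneg_left (h.norm_le x hx) (norm_nonneg _)
  induction n generalizing u with
  | zero => exact h0
  | succ n ih =>
    refine ⟨h0, fun j => ?_⟩
    rw [partialDeriv_const_smul c hu]
    simp only [smul_comm ε c]
    have h1 := h.2 j
    refine ih (contDiff_smul_partialDeriv hu ε j) h1 fun x hx => ?_
    rw [norm_smul]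
    exact mul_le_mul_of_nonneg_left (h1.norm_le x hx) (norm_nonneg _)

theorem DerivBound.zero (hW : ∀ x ∈ K, 0 ≤ W x) :
    DerivBound ε K n W (fun _ => (0 : F)) := by
  induction n with
  | zero => simpa [DerivBound] using hW
  | succ n ih =>
    refine ⟨by simpa using hW, fun j => ?_⟩
    simpa [partialDeriv] using ih

theorem DerivBound.sum {ι : Type*} (s : Finset ι) {u : ι → EuclideanSpace ℝ (Fin d) → F}
    (hu : ∀ i, ContDiff ℝ ∞ (u i)) (h : ∀ i, DerivBound ε K n W (u i)) :
    DerivBound ε K n (fun x => (s.card : ℝ) * W x) (fun x => ∑ i ∈ s, u i x) := by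
  classical
  induction s using Finset.induction_on with
  | empty => simpa using DerivBound.zero (by simp)
  | insert a s ha ih =>
    simp only [Finset.sum_insert ha]
    refine ((h a).add (hu a) (ContDiff.sum fun i _ => hu i) ih).mono fun x _ => ?_
    rw [Finset.card_insert_of_notMem ha]
    push_cast
    linarith

/-- One weight serves all orders of derivative, so weights simply multiply; the Leibniz rule doubles
the number of terms at each order, whence 2^n. -/
theorem DerivBound.smul {f : EuclideanSpace ℝ (Fin d) → ℝ} {u : EuclideanSpace ℝ (Fin d) → F}
    (hf : ContDiff ℝ ∞ f) (hu : ContDiff ℝ ∞ u)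
    (h : DerivBound ε K n W f) (h' : DerivBound ε K n W' u) :
    DerivBound ε K n (fun x => 2 ^ n * (W x * W' x)) (fun x => f x • u x) := by
  have h0 : ∀ x ∈ K, ‖f x • u x‖ ≤ W x * W' x := fun x hx => by
    rw [norm_smul]
    exact mul_le_mul (h.norm_le x hx) (h'.norm_le x hx) (norm_nonneg _)
      ((norm_nonneg _).trans (h.norm_le x hx))
  induction n generalizing f u with
  | zero => simpa [DerivBound] using h0
  | succ n ih =>
    refine ⟨fun x hx => (h0 x hx).trans ?_, fun j => ?_⟩
    · exact le_mul_of_one_le_left ((norm_nonneg _).trans (h0 x hx)) (one_le_pow₀ (by norm_num))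
    · rw [partialDeriv_smul hf hu]
      have e : (fun x => ε • (partialDeriv j f x • u x + f x • partialDeriv j u x)) =
          fun x => (ε • partialDeriv j f x) • u x + f x • (ε • partialDeriv j u x) := by
        funext x
        rw [smul_add, smul_assoc, smul_comm ε (f x)]
      rw [e]
      have hf' : ContDiff ℝ ∞ (fun x => ε • partialDeriv j f x) :=
        contDiff_smul_partialDeriv hf ε j
      have hu' : ContDiff ℝ ∞ (fun x => ε • partialDeriv j u x) :=
        contDiff_smul_partialDeriv hu ε j
      have key : ∀ {f : EuclideanSpace ℝ (Fin d) → ℝ} {u : EuclideanSpace ℝ (Fin d) → F},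
          DerivBound ε K n W f → DerivBound ε K n W' u →
          ∀ x ∈ K, ‖f x • u x‖ ≤ W x * W' x := fun h h' x hx => by
        rw [norm_smul]
        exact mul_le_mul (h.norm_le x hx) (h'.norm_le x hx) (norm_nonneg _)
          ((norm_nonneg _).trans (h.norm_le x hx))
      refine ((ih hf' hu (h.2 j) h'.of_succ (key (h.2 j) h'.of_succ)).add (hf'.smul hu)
        (hf.smul hu') (ih hf hu' h.of_succ (h'.2 j) (key h.of_succ (h'.2 j)))).mono fun x _ => ?_
      rw [pow_succ]
      linarith

/-- Since ε ≤ 1, the powers of ε in front of the derivatives can be dropped. -/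
theorem DerivBound.of_foldr {B : ℝ} (hε : 0 ≤ ε) (hε1 : ε ≤ 1)
    {u : EuclideanSpace ℝ (Fin d) → F} (hu : ContDiff ℝ ∞ u)
    (h : ∀ l : List (Fin d), l.length ≤ n → ∀ x ∈ K, ‖l.foldr partialDeriv u x‖ ≤ B) :
    DerivBound ε K n (fun _ => B) u := by
  induction n generalizing u with
  | zero => exact fun x hx => h [] le_rfl x hx
  | succ n ih =>
    refine ⟨fun x hx => h [] (by simp) x hx, fun j => ?_⟩
    refine ih (contDiff_smul_partialDeriv hu ε j) fun l hl x hx => ?_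
    rw [(foldr_partialDeriv_const_smul ε (contDiff_partialDeriv hu j) l).2]
    -- `foldr` applies the last index of the list first, so the innermost derivative ∂ⱼ goes at the
    -- end.
    have := h (l ++ [j]) (by simpa using hl) x hx
    rw [List.foldr_append] at this
    rw [norm_smul, Real.norm_of_nonneg hε]
    exact (mul_le_of_le_one_left (norm_nonneg _) hε1).trans this

end DerivBound

/-! ### Repeated integration by parts. -/

section Transport

variable {d : ℕ}

theorem partialDeriv_complex_mul {f u : EuclideanSpace ℝ (Fin d) → ℂ}
    (hf : ContDiff ℝ ∞ f) (hu : ContDiff ℝ ∞ u) (i : Fin d) :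
    partialDeriv i (fun x => f x * u x) =
      fun x => partialDeriv i f x * u x + f x * partialDeriv i u x := by
  funext x
  unfold partialDeriv
  rw [fderiv_fun_mul (hf.differentiable (by simp) x) (hu.differentiable (by simp) x)]
  simp [mul_comm, add_comm]

theorem integral_partialDeriv_eq_zero {f : EuclideanSpace ℝ (Fin d) → ℂ}
    (hf : ContDiff ℝ ∞ f) (hc : HasCompactSupport f) (i : Fin d) :
    ∫ x, partialDeriv i f x = 0 := by
  have hc' : HasCompactSupport (partialDeriv i f) :=
    hc.mono' ((subset_tsupport _).trans (tsupport_partialDeriv_subset f i))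
  have h1 : Integrable (partialDeriv i f) :=
    (contDiff_partialDeriv hf i).continuous.integrable_of_hasCompactSupport hc'
  have h2 : Integrable f := hf.continuous.integrable_of_hasCompactSupport hc
  -- Integration by parts against the constant function 1.
  have := integral_smul_fderiv_eq_neg_fderiv_smul_of_integrable (𝕜 := ℝ) (μ := volume)
    (f := fun _ : EuclideanSpace ℝ (Fin d) => (1 : ℝ)) (g := f)
    (v := EuclideanSpace.single i 1) (by simp) (by simpa only [one_smul] using! h1)
    (by simpa only [one_smul] using h2)
    (fun x _ => differentiableAt_const _) (fun x _ => hf.differentiable (by simp) x)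
  simpa [partialDeriv] using this

/-- The weight `(1 + |g|²)⁻¹` of a vector field `g`. -/
noncomputable def fieldWeight (g : Fin d → EuclideanSpace ℝ (Fin d) → ℝ)
    (x : EuclideanSpace ℝ (Fin d)) : ℝ :=
  (1 + ∑ k, g k x ^ 2)⁻¹

/-- The transpose of the first order operator `(1 + |g|²)⁻¹ (1 - i ε g · ∂)`. -/
noncomputable def transportTranspose (ε : ℝ) (g : Fin d → EuclideanSpace ℝ (Fin d) → ℝ)
    (u : EuclideanSpace ℝ (Fin d) → ℂ) (x : EuclideanSpace ℝ (Fin d)) : ℂ :=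
  fieldWeight g x • u x +
    Complex.I • ∑ j, ε • partialDeriv j (fun y => (fieldWeight g y • g j y) • u y) x

variable {ε : ℝ} {K : Set (EuclideanSpace ℝ (Fin d))}
  {g : Fin d → EuclideanSpace ℝ (Fin d) → ℝ} {u : EuclideanSpace ℝ (Fin d) → ℂ}

theorem one_le_one_add_sum_sq (g : Fin d → EuclideanSpace ℝ (Fin d) → ℝ)
    (x : EuclideanSpace ℝ (Fin d)) : 1 ≤ 1 + ∑ k, g k x ^ 2 :=
  le_add_of_nonneg_right (Finset.sum_nonneg fun _ _ => sq_nonneg _)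

theorem fieldWeight_pos (g : Fin d → EuclideanSpace ℝ (Fin d) → ℝ)
    (x : EuclideanSpace ℝ (Fin d)) : 0 < fieldWeight g x :=
  inv_pos.2 (zero_lt_one.trans_le (one_le_one_add_sum_sq g x))

theorem fieldWeight_le_one (g : Fin d → EuclideanSpace ℝ (Fin d) → ℝ)
    (x : EuclideanSpace ℝ (Fin d)) : fieldWeight g x ≤ 1 :=
  inv_le_one_of_one_le₀ (one_le_one_add_sum_sq g x)

theorem sqrt_fieldWeight_le_one (g : Fin d → EuclideanSpace ℝ (Fin d) → ℝ)
    (x : EuclideanSpace ℝ (Fin d)) : √(fieldWeight g x) ≤ 1 :=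
  Real.sqrt_le_one.2 (fieldWeight_le_one g x)

theorem fieldWeight_le_sqrt (g : Fin d → EuclideanSpace ℝ (Fin d) → ℝ)
    (x : EuclideanSpace ℝ (Fin d)) : fieldWeight g x ≤ √(fieldWeight g x) :=
  Real.le_sqrt_of_sq_le
    (by nlinarith [fieldWeight_pos g x, fieldWeight_le_one g x])

/-- Writing w for the weight, w²gₖ² ≤ w · w(1 + |g|²) = w. The factor gₖ thus costs half a power of
w, which is why each integration by parts gains only √w. -/
theorem abs_fieldWeight_mul_le (g : Fin d → EuclideanSpace ℝ (Fin d) → ℝ)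
    (k : Fin d) (x : EuclideanSpace ℝ (Fin d)) :
    |fieldWeight g x * g k x| ≤ √(fieldWeight g x) := by
  apply Real.abs_le_sqrt
  have h0 := fieldWeight_pos g x
  have h1 : fieldWeight g x * (1 + ∑ k, g k x ^ 2) = 1 :=
    inv_mul_cancel₀ (zero_lt_one.trans_le (one_le_one_add_sum_sq g x)).ne'
  have h2 : g k x ^ 2 ≤ 1 + ∑ k, g k x ^ 2 :=
    (Finset.single_le_sum (f := fun k => g k x ^ 2) (fun _ _ => sq_nonneg _)
      (Finset.mem_univ k)).trans (by linarith)
  calc (fieldWeight g x * g k x) ^ 2 = fieldWeight g x * (fieldWeight g x * g k x ^ 2) := by ring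
    _ ≤ fieldWeight g x * (fieldWeight g x * (1 + ∑ k, g k x ^ 2)) := by gcongr
    _ = fieldWeight g x := by rw [h1, mul_one]

theorem contDiff_fieldWeight (hg : ∀ k, ContDiff ℝ ∞ (g k)) : ContDiff ℝ ∞ (fieldWeight g) :=
  (contDiff_const.add (ContDiff.sum fun k _ => (hg k).pow 2)).inv
    fun x => (zero_lt_one.trans_le (one_le_one_add_sum_sq g x)).ne'

theorem contDiff_fieldWeight_smul (hg : ∀ k, ContDiff ℝ ∞ (g k)) (k : Fin d) :
    ContDiff ℝ ∞ (fun x => fieldWeight g x • g k x) :=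
  (contDiff_fieldWeight hg).smul (hg k)

theorem contDiff_transportTranspose (hg : ∀ k, ContDiff ℝ ∞ (g k)) (hu : ContDiff ℝ ∞ u) :
    ContDiff ℝ ∞ (transportTranspose ε g u) :=
  ((contDiff_fieldWeight hg).smul hu).add ((ContDiff.sum fun j _ =>
    contDiff_smul_partialDeriv ((contDiff_fieldWeight_smul hg j).smul hu) ε j).const_smul Complex.I)

theorem tsupport_transportTranspose_subset :
    tsupport (transportTranspose ε g u) ⊆ tsupport u := by
  refine closure_minimal (fun x hx => ?_) isClosed_closure
  by_contra hxu
  apply hx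
  have h : ∀ j, partialDeriv j (fun y => (fieldWeight g y • g j y) • u y) x = 0 := fun j => by
    apply image_eq_zero_of_notMem_tsupport
    intro hx'
    exact hxu (tsupport_smul_subset_right _ u (tsupport_partialDeriv_subset _ j hx'))
  simp only [transportTranspose, h, smul_zero, Finset.sum_const_zero, add_zero,
    image_eq_zero_of_notMem_tsupport hxu]

/-- Integration by parts against an oscillating factor `e` with `ε ∂ⱼ e = i gⱼ e`. -/
theorem integral_mul_transportTranspose (hg : ∀ k, ContDiff ℝ ∞ (g k)) (hu : ContDiff ℝ ∞ u)
    (hc : HasCompactSupport u) {e : EuclideanSpace ℝ (Fin d) → ℂ} (he : ContDiff ℝ ∞ e)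
    (hge : ∀ j x, ε • partialDeriv j e x = Complex.I * (g j x : ℂ) * e x) :
    ∫ x, e x * transportTranspose ε g u x = ∫ x, e x * u x := by
  set q : Fin d → EuclideanSpace ℝ (Fin d) → ℂ := fun j x => (fieldWeight g x • g j x) • u x
    with hq
  have hqs : ∀ j, ContDiff ℝ ∞ (q j) := fun j => (contDiff_fieldWeight_smul hg j).smul hu
  have heq : ∀ j, ContDiff ℝ ∞ (fun x => e x * q j x) := fun j => he.mul (hqs j)
  have hcq : ∀ j, HasCompactSupport (fun x => e x * q j x) := fun j =>
    (hc.smul_left (f := fun x => fieldWeight g x • g j x)).mul_left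
  -- Moving ∂ⱼ outside the product with e leaves |g|² w e u, because i · i = -1; with w e u it adds
  -- up to e u, and the rest is a divergence.
  have hpt : ∀ x, e x * transportTranspose ε g u x =
      e x * u x + Complex.I * ∑ j, ε • partialDeriv j (fun y => e y * q j y) x := by
    intro x
    have h1 : ∀ j, ε • partialDeriv j (fun y => e y * q j y) x =
        Complex.I * (g j x : ℂ) ^ 2 * (fieldWeight g x * e x * u x) +
          e x * (ε • partialDeriv j (q j) x) := by
      intro j
      rw [partialDeriv_complex_mul he (hqs j), smul_add, ← smul_mul_assoc, hge, mul_smul_comm]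
      simp only [hq, smul_eq_mul, Complex.real_smul, Complex.ofReal_mul]
      ring
    have h2 : (fieldWeight g x : ℂ) * (1 + ∑ k, (g k x : ℂ) ^ 2) = 1 := by
      have := inv_mul_cancel₀ (zero_lt_one.trans_le (one_le_one_add_sum_sq g x)).ne'
      exact_mod_cast congrArg (fun r : ℝ => (r : ℂ)) this
    simp only [h1, Finset.sum_add_distrib, ← Finset.sum_mul, ← Finset.mul_sum]
    simp only [transportTranspose, Complex.real_smul, smul_eq_mul]
    simp only [hq, Complex.real_smul, smul_eq_mul]
    linear_combination (e x * u x) * h2 + (- (∑ k, (g k x : ℂ) ^ 2) * fieldWeight g x * e x * u x)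
      * Complex.I_mul_I
  simp only [hpt]
  have hint : ∀ j, Integrable (fun x => ε • partialDeriv j (fun y => e y * q j y) x) := fun j =>
    ((contDiff_partialDeriv (heq j) j).continuous.integrable_of_hasCompactSupport
      ((hcq j).mono' ((subset_tsupport _).trans (tsupport_partialDeriv_subset _ j)))).smul ε
  rw [integral_add, integral_const_mul, integral_finsetSum _ fun j _ => hint j]
  · simp only [integral_smul, integral_partialDeriv_eq_zero (heq _) (hcq _)]
    simp
  · exact (he.mul hu).continuous.integrable_of_hasCompactSupport hc.mul_left
  · exact (integrable_finsetSum _ fun j _ => hint j).const_mul _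

/-- The point of this form, and of the companion formula for w gₖ, is closure: ε∂ⱼ turns w and w gₖ
into polynomials in w, w gₗ and h, with no bare, unbounded g left over. -/
theorem smul_partialDeriv_fieldWeight (hg : ∀ k, ContDiff ℝ ∞ (g k))
    {h : Fin d → Fin d → EuclideanSpace ℝ (Fin d) → ℝ}
    (hgh : ∀ j k x, ε • partialDeriv j (g k) x = h j k x) (j : Fin d) :
    (fun x => ε • partialDeriv j (fieldWeight g) x) = fun x => (-2 : ℝ) •
      (fieldWeight g x • ∑ l, (fieldWeight g x • g l x) • h j l x) := by
  funext x
  have hne : (1 + ∑ k, g k x ^ 2) ≠ 0 := (zero_lt_one.trans_le (one_le_one_add_sum_sq g x)).ne'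
  have h1 : HasFDerivAt (fun x => 1 + ∑ k, g k x ^ 2)
      (∑ k, (2 * g k x) • fderiv ℝ (g k) x) x := by
    refine HasFDerivAt.const_add _ (HasFDerivAt.fun_sum fun k _ => ?_)
    simpa using ((hg k).differentiable (by simp) x).hasFDerivAt.pow 2
  have h2 := (hasDerivAt_inv hne).comp_hasFDerivAt x h1
  have h3 : partialDeriv j (fieldWeight g) x =
      -(fieldWeight g x ^ 2) * ∑ k, 2 * g k x * partialDeriv j (g k) x := by
    unfold partialDeriv
    rw [show fieldWeight g = Inv.inv ∘ fun x => 1 + ∑ k, g k x ^ 2 from rfl, h2.fderiv]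
    simp
  rw [h3]
  simp only [← hgh, smul_eq_mul, Finset.mul_sum]
  exact Finset.sum_congr rfl fun k _ => by ring

theorem smul_partialDeriv_fieldWeight_smul (hg : ∀ k, ContDiff ℝ ∞ (g k))
    {h : Fin d → Fin d → EuclideanSpace ℝ (Fin d) → ℝ}
    (hgh : ∀ j k x, ε • partialDeriv j (g k) x = h j k x) (j k : Fin d) :
    (fun x => ε • partialDeriv j (fun y => fieldWeight g y • g k y) x) = fun x => (-2 : ℝ) •
      ((fieldWeight g x • g k x) • ∑ l, (fieldWeight g x • g l x) • h j l x) +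
        fieldWeight g x • h j k x := by
  funext x
  have := congrFun (smul_partialDeriv_fieldWeight hg hgh j) x
  rw [partialDeriv_smul (contDiff_fieldWeight hg) (hg k), ← hgh j k]
  simp only [smul_eq_mul] at this ⊢
  linear_combination g k x * this

/-- Induction on n through the closed system for w and w gₖ: every term of a derivative keeps a
factor w or w gₗ, hence a factor √w. One derivative of g is already spent in h, so order n - 1 of h
suffices. -/
theorem exists_derivBound_fieldWeight (d n : ℕ) : ∃ C : ℝ, 1 ≤ C ∧
    ∀ (ε : ℝ) (K : Set (EuclideanSpace ℝ (Fin d))) (g : Fin d → EuclideanSpace ℝ (Fin d) → ℝ)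
      (h : Fin d → Fin d → EuclideanSpace ℝ (Fin d) → ℝ),
      (∀ k, ContDiff ℝ ∞ (g k)) → (∀ j k, ContDiff ℝ ∞ (h j k)) →
      (∀ j k x, ε • partialDeriv j (g k) x = h j k x) →
      (∀ j k, DerivBound ε K (n - 1) (fun _ => 1) (h j k)) →
      DerivBound ε K n (fun x => C * √(fieldWeight g x)) (fieldWeight g) ∧
      ∀ k, DerivBound ε K n (fun x => C * √(fieldWeight g x))
        (fun x => fieldWeight g x • g k x) := by
  induction n with
  | zero =>
    refine ⟨1, le_rfl, fun ε K g h hg hh hgh hb => ⟨fun x _ => ?_, fun k x _ => ?_⟩⟩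
    · simp only [Real.norm_of_nonneg (fieldWeight_pos g x).le, one_mul]
      exact fieldWeight_le_sqrt g x
    · simp only [one_mul]
      exact abs_fieldWeight_mul_le g k x
  | succ n ih =>
    obtain ⟨C, hC, ih⟩ := ih
    have h2n : (1 : ℝ) ≤ 2 ^ n := one_le_pow₀ (by norm_num)
    -- The bound for -2 f ∑ₗ (w gₗ) hⱼₗ: two Leibniz factors 2^n and d summands.
    set A : ℝ := 2 * (2 ^ n * (C * (d * (2 ^ n * C)))) with hA
    have hA0 : 0 ≤ A := by positivity
    have hCC : C ≤ 2 ^ n * C := le_mul_of_one_le_left (by linarith) h2n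
    refine ⟨A + 2 ^ n * C, by linarith, fun ε K g h hg hh hgh hb => ?_⟩
    obtain ⟨ihw, ihp⟩ := ih ε K g h hg hh hgh fun j k => (hb j k).of_le (by omega)
    have hb' : ∀ j k, DerivBound ε K n (fun _ => 1) (h j k) := hb
    have hw := contDiff_fieldWeight hg
    have hp := contDiff_fieldWeight_smul hg
    have hph : ∀ j l, ContDiff ℝ ∞ fun x => (fieldWeight g x • g l x) • h j l x :=
      fun j l => (hp l).smul (hh j l)
    have hphs : ∀ j, ContDiff ℝ ∞ fun x => ∑ l, (fieldWeight g x • g l x) • h j l x :=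
      fun j => ContDiff.sum fun l _ => hph j l
    have hS : ∀ j, DerivBound ε K n (fun x => d * (2 ^ n * (C * √(fieldWeight g x) * 1)))
        (fun x => ∑ l, (fieldWeight g x • g l x) • h j l x) := fun j => by
      simpa using DerivBound.sum Finset.univ (hph j)
        (fun l => (ihp l).smul (hp l) (hh j l) (hb' j l))
    have hquad : ∀ (f : EuclideanSpace ℝ (Fin d) → ℝ), ContDiff ℝ ∞ f →
        DerivBound ε K n (fun x => C * √(fieldWeight g x)) f → ∀ j,
        DerivBound ε K n (fun x => A * √(fieldWeight g x))
          (fun x => (-2 : ℝ) • (f x • ∑ l, (fieldWeight g x • g l x) • h j l x)) := by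
      intro f hf hfb j
      refine ((hfb.smul hf (hphs j) (hS j)).const_smul (-2 : ℝ) (hf.smul (hphs j))).mono
        fun x _ => ?_
      have hs : √(fieldWeight g x) * √(fieldWeight g x) ≤ √(fieldWeight g x) :=
        mul_le_of_le_one_left (Real.sqrt_nonneg _) (sqrt_fieldWeight_le_one g x)
      calc _ = A * (√(fieldWeight g x) * √(fieldWeight g x)) := by
            rw [hA]; norm_num; ring
        _ ≤ _ := mul_le_mul_of_nonneg_left hs hA0
    refine ⟨⟨fun x hx => (ihw.norm_le x hx).trans ?_, fun j => ?_⟩,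
      fun k => ⟨fun x hx => ((ihp k).norm_le x hx).trans ?_, fun j => ?_⟩⟩
    · exact mul_le_mul_of_nonneg_right (by linarith) (Real.sqrt_nonneg _)
    · rw [smul_partialDeriv_fieldWeight hg hgh]
      refine (hquad _ hw ihw j).mono fun x _ => ?_
      gcongr
      linarith
    · exact mul_le_mul_of_nonneg_right (by linarith) (Real.sqrt_nonneg _)
    · rw [smul_partialDeriv_fieldWeight_smul hg hgh]
      refine ((hquad _ (hp k) (ihp k) j).add (((hp k).smul (hphs j)).const_smul (-2 : ℝ))
        (hw.smul (hh j k)) (ihw.smul hw (hh j k) (hb' j k))).mono fun x _ => ?_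
      exact le_of_eq (by ring)

/-- The 1 + d terms of the operator are all products of u with w or w gⱼ, differentiated at most
once, so one order of control is traded for a factor √w. -/
theorem DerivBound.transportTranspose {N n : ℕ} {C : ℝ} {W : EuclideanSpace ℝ (Fin d) → ℝ}
    (hC : 0 ≤ C) (hnN : n + 1 ≤ N) (hg : ∀ k, ContDiff ℝ ∞ (g k)) (hu : ContDiff ℝ ∞ u)
    (hw : DerivBound ε K N (fun x => C * √(fieldWeight g x)) (fieldWeight g))
    (hp : ∀ k, DerivBound ε K N (fun x => C * √(fieldWeight g x))
        (fun x => fieldWeight g x • g k x))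
    (h : DerivBound ε K (n + 1) W u) :
    DerivBound ε K n (fun x => 2 ^ N * C * (1 + d) * √(fieldWeight g x) * W x)
      (transportTranspose ε g u) := by
  have hws := contDiff_fieldWeight hg
  have hps := contDiff_fieldWeight_smul hg
  have h1 := (hw.of_le (n := n) (by omega)).smul hws hu h.of_succ
  have h2 := fun j => ((hp j).of_le hnN).smul (hps j) hu h
  have hs := fun j => contDiff_smul_partialDeriv ((hps j).smul hu) ε j
  have h3 := (DerivBound.sum Finset.univ hs fun j => (h2 j).2 j).const_smul Complex.I
    (ContDiff.sum fun j _ => hs j)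
  refine (h1.add (hws.smul hu) ((ContDiff.sum fun j _ => hs j).const_smul Complex.I) h3).mono
    fun x hx => ?_
  have hW : 0 ≤ W x := (norm_nonneg _).trans (h.norm_le x hx)
  have e1 : (2 : ℝ) ^ n ≤ 2 ^ N := pow_le_pow_right₀ (by norm_num) (by omega)
  have e2 : (2 : ℝ) ^ (n + 1) ≤ 2 ^ N := pow_le_pow_right₀ (by norm_num) hnN
  have e0 : 0 ≤ C * √(fieldWeight g x) * W x := by positivity
  rw [Complex.norm_I, one_mul, Finset.card_univ, Fintype.card_fin]
  calc _ ≤ 2 ^ N * (C * √(fieldWeight g x) * W x) +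
        d * (2 ^ N * (C * √(fieldWeight g x) * W x)) := by gcongr
    _ = _ := by ring

/-- Repeated integration by parts: an oscillatory integral is dominated by the integral of a power
of the weight. -/
theorem exists_norm_integral_le_integral_fieldWeight (d N : ℕ) : ∃ C : ℝ, 0 < C ∧
    ∀ (ε B : ℝ) (g : Fin d → EuclideanSpace ℝ (Fin d) → ℝ)
      (h : Fin d → Fin d → EuclideanSpace ℝ (Fin d) → ℝ) (e b : EuclideanSpace ℝ (Fin d) → ℂ),
      (∀ k, ContDiff ℝ ∞ (g k)) → (∀ j k, ContDiff ℝ ∞ (h j k)) →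
      ContDiff ℝ ∞ e → ContDiff ℝ ∞ b → HasCompactSupport b →
      (∀ j k x, ε • partialDeriv j (g k) x = h j k x) →
      (∀ j x, ε • partialDeriv j e x = Complex.I * (g j x : ℂ) * e x) →
      (∀ x, ‖e x‖ ≤ 1) →
      (∀ j k, DerivBound ε (tsupport b) (N - 1) (fun _ => 1) (h j k)) →
      DerivBound ε (tsupport b) N (fun _ => B) b →
      ‖∫ x, e x * b x‖ ≤ C * B * ∫ x in tsupport b, √(fieldWeight g x) ^ N := by
  obtain ⟨C, hC, hCb⟩ := exists_derivBound_fieldWeight d N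
  refine ⟨(2 ^ N * C * (1 + d)) ^ N, by positivity,
    fun ε B g h e b hg hh he hb hcb hgh hge he1 hhb hbb => ?_⟩
  obtain ⟨hw, hp⟩ := hCb ε (tsupport b) g h hg hh hgh hhb
  -- Invariant after m transpositions: N - m orders are still controlled, m factors √w are gained,
  -- and the integral is unchanged.
  have key : ∀ m ≤ N, ContDiff ℝ ∞ ((transportTranspose ε g)^[m] b) ∧
      tsupport ((transportTranspose ε g)^[m] b) ⊆ tsupport b ∧
      DerivBound ε (tsupport b) (N - m)
        (fun x => (2 ^ N * C * (1 + d) * √(fieldWeight g x)) ^ m * B)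
        ((transportTranspose ε g)^[m] b) ∧
      ∫ x, e x * (transportTranspose ε g)^[m] b x = ∫ x, e x * b x := by
    intro m hm
    induction m with
    | zero => exact ⟨hb, subset_rfl, by simpa using hbb, rfl⟩
    | succ m ih =>
      obtain ⟨i1, i2, i3, i4⟩ := ih (by omega)
      rw [Function.iterate_succ_apply']
      refine ⟨contDiff_transportTranspose hg i1, tsupport_transportTranspose_subset.trans i2,
        ?_, ?_⟩
      · rw [show N - m = N - (m + 1) + 1 by omega] at i3
        refine (DerivBound.transportTranspose (by linarith) (show N - (m + 1) + 1 ≤ N by omega)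
          hg i1 hw hp i3).mono fun x _ => ?_
        exact le_of_eq (by ring)
      · rw [← i4]
        exact integral_mul_transportTranspose hg i1
          (hcb.mono' ((subset_tsupport _).trans i2)) he hge
  obtain ⟨-, k2, k3, k4⟩ := key N le_rfl
  have hcont : Continuous fun x => √(fieldWeight g x) ^ N :=
    ((contDiff_fieldWeight hg).continuous.sqrt).pow N
  rw [← k4, ← setIntegral_eq_integral_of_forall_compl_eq_zero (s := tsupport b)]
  · rw [← integral_const_mul]
    refine norm_integral_le_of_norm_le
      ((hcont.continuousOn.integrableOn_compact hcb).const_mul _) ?_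
    refine (ae_restrict_iff' hcb.measurableSet).2 (.of_forall fun x hx => ?_)
    rw [norm_mul]
    refine (mul_le_of_le_one_left (norm_nonneg _) (he1 x)).trans ((k3.norm_le x hx).trans ?_)
    exact le_of_eq (by rw [mul_pow]; ring)
  · intro x hx
    rw [image_eq_zero_of_notMem_tsupport fun h => hx (k2 h), mul_zero]

end Transport

/-! ### The gradient map as a change of variables. -/

section ChangeOfVariables

variable {d : ℕ}

theorem gradient_apply_eq_partialDeriv (Φ : EuclideanSpace ℝ (Fin d) → ℝ)
    (x : EuclideanSpace ℝ (Fin d)) (k : Fin d) : gradient Φ x k = partialDeriv k Φ x := by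
  have h : inner ℝ (gradient Φ x) (EuclideanSpace.single k 1) =
      fderiv ℝ Φ x (EuclideanSpace.single k 1) := by
    rw [gradient, InnerProductSpace.toDual_symm_apply]
  rw [EuclideanSpace.inner_single_right] at h
  simpa [partialDeriv] using h

theorem differentiable_gradient {Φ : EuclideanSpace ℝ (Fin d) → ℝ} (hΦ : ContDiff ℝ ∞ Φ) :
    Differentiable ℝ (gradient Φ) := by
  rw [differentiable_euclidean]
  intro k
  simp only [gradient_apply_eq_partialDeriv]
  exact (contDiff_partialDeriv hΦ k).differentiable (by simp)

theorem det_fderiv_gradient {Φ : EuclideanSpace ℝ (Fin d) → ℝ} (hΦ : ContDiff ℝ ∞ Φ)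
    (x : EuclideanSpace ℝ (Fin d)) :
    (fderiv ℝ (gradient Φ) x).det = (hessianMatrix Φ x).det := by
  set b := (EuclideanSpace.basisFun (Fin d) ℝ).toBasis
  -- The Jacobian has ∂ⱼ∂ₖΦ in row k and column j; transposing matches the Hessian convention
  -- without using its symmetry.
  rw [ContinuousLinearMap.det, ← LinearMap.det_toMatrix b, ← Matrix.det_transpose]
  congr 1
  ext j k
  have h := (EuclideanSpace.proj (𝕜 := ℝ) k).hasFDerivAt.comp x
    (differentiable_gradient hΦ x).hasFDerivAt
  rw [show (EuclideanSpace.proj (𝕜 := ℝ) k : EuclideanSpace ℝ (Fin d) → ℝ) ∘ gradient Φ =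
    fun y => partialDeriv k Φ y from
      funext fun y => gradient_apply_eq_partialDeriv Φ y k] at h
  have h' := h.fderiv
  simp only [hessianMatrix, Matrix.of_apply, Matrix.transpose_apply, LinearMap.toMatrix_apply]
  change _ = fderiv ℝ (fun y => partialDeriv k Φ y) x _
  rw [h']
  simp [b]

theorem sqrt_inv_pow_eq_rpow {t : ℝ} (ht : 0 ≤ t) (n : ℕ) :
    √(t⁻¹) ^ n = t ^ (-(n : ℝ) / 2) := by
  rw [Real.sqrt_eq_rpow, ← Real.rpow_neg_one, ← Real.rpow_mul ht, ← Real.rpow_natCast,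
    ← Real.rpow_mul ht]
  congr 1
  ring

/-- Change of variables `η = ∇Φ(ξ)` in the integral of the weight. -/
theorem exists_setIntegral_fieldWeight_le (d : ℕ) : ∃ C : ℝ, 0 < C ∧
    ∀ (Φ : EuclideanSpace ℝ (Fin d) → ℝ) (K : Set (EuclideanSpace ℝ (Fin d))) (a₀ σ : ℝ),
      ContDiff ℝ ∞ Φ → IsCompact K → 0 < a₀ → 0 < σ →
      (∀ ξ ∈ K, a₀ ≤ |(hessianMatrix Φ ξ).det|) → Set.InjOn (gradient Φ) K →
      ∫ x in K, √(fieldWeight (fun k x => σ • partialDeriv k Φ x) x) ^ (d + 1) ≤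
        C / a₀ * (σ ^ d)⁻¹ := by
  set G : EuclideanSpace ℝ (Fin d) → ℝ := fun y => √((1 + ‖y‖ ^ 2)⁻¹) ^ (d + 1) with hG
  have hG0 : ∀ y, 0 ≤ G y := fun y => by positivity
  have hGi : Integrable G := by
    -- Integrability needs decay exponent greater than d, and d + 1 is the first integer that works.
    have := integrable_rpow_neg_one_add_norm_sq (E := EuclideanSpace ℝ (Fin d)) (μ := volume)
      (r := ((d + 1 : ℕ) : ℝ)) (by simp)
    refine this.congr (.of_forall fun y => ?_)
    exact (sqrt_inv_pow_eq_rpow (by positivity) _).symm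
  have hI : 0 ≤ ∫ y, G y := integral_nonneg hG0
  -- The extra 1 makes the constant positive from nonnegativity of the integral alone.
  refine ⟨(∫ y, G y) + 1, by linarith, fun Φ K a₀ σ hΦ hK ha hσ hdet hinj => ?_⟩
  have hw : ∀ x, √(fieldWeight (fun k x => σ • partialDeriv k Φ x) x) ^ (d + 1) =
      G (σ • gradient Φ x) := fun x => by
    simp [hG, fieldWeight, EuclideanSpace.norm_sq_eq, gradient_apply_eq_partialDeriv]
  have hfd : ∀ x ∈ K, HasFDerivWithinAt (gradient Φ) (fderiv ℝ (gradient Φ) x) K x :=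
    fun x _ => (differentiable_gradient hΦ x).hasFDerivAt.hasFDerivWithinAt
  have hGs : Integrable fun y => G (σ • y) := hGi.comp_smul hσ.ne'
  have hGc : Continuous G := by
    refine ((Continuous.inv₀ (by fun_prop) fun y => ?_).sqrt).pow _
    positivity
  have hint : IntegrableOn
      (fun x => |(fderiv ℝ (gradient Φ) x).det| • G (σ • gradient Φ x)) K :=
    (integrableOn_image_iff_integrableOn_abs_det_fderiv_smul volume hK.measurableSet hfd hinj
      fun y => G (σ • y)).1 hGs.integrableOn
  have hcont : Continuous fun x => G (σ • gradient Φ x) :=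
    hGc.comp ((differentiable_gradient hΦ).continuous.const_smul σ)
  simp only [hw]
  calc ∫ x in K, G (σ • gradient Φ x)
      ≤ ∫ x in K, a₀⁻¹ * (|(fderiv ℝ (gradient Φ) x).det| • G (σ • gradient Φ x)) := by
        refine setIntegral_mono_on (hcont.continuousOn.integrableOn_compact hK)
          (hint.const_mul _) hK.measurableSet fun x hx => ?_
        rw [det_fderiv_gradient hΦ, smul_eq_mul, ← mul_assoc]
        refine le_mul_of_one_le_left (hG0 _) ?_
        rw [inv_mul_eq_div, one_le_div ha]
        exact hdet x hx
    _ = a₀⁻¹ * ∫ y in gradient Φ '' K, G (σ • y) := by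
        rw [integral_const_mul, integral_image_eq_integral_abs_det_fderiv_smul volume
          hK.measurableSet hfd hinj fun y => G (σ • y)]
    _ ≤ a₀⁻¹ * ∫ y, G (σ • y) := by
        refine mul_le_mul_of_nonneg_left ?_ (inv_nonneg.2 ha.le)
        exact setIntegral_le_integral hGs (.of_forall fun y => hG0 _)
    _ = (∫ y, G y) / a₀ * (σ ^ d)⁻¹ := by
        rw [Measure.integral_comp_smul_of_nonneg volume G σ (hR := hσ.le), finrank_euclideanSpace,
          Fintype.card_fin, smul_eq_mul]
        ring
    _ ≤ _ := by gcongr; linarith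

end ChangeOfVariables

/-! ### The phase factor, and the choice of scales. -/

section MainEstimate

variable {d : ℕ} {F : Type*} [NormedAddCommGroup F] [NormedSpace ℝ F]

theorem norm_foldr_partialDeriv_le_toReal {f : EuclideanSpace ℝ (Fin d) → F}
    (hf : ContDiff ℝ ∞ f) {s : Finset ℕ} {S : Set (EuclideanSpace ℝ (Fin d))}
    (hfin : (∑ j ∈ s, ∑ α ∈ multiIndices d j, ⨆ ξ ∈ S, ‖multiDeriv α f ξ‖ₑ) < ⊤)
    (l : List (Fin d)) (hl : l.length ∈ s) {x : EuclideanSpace ℝ (Fin d)} (hx : x ∈ S) :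
    ‖l.foldr partialDeriv f x‖ ≤
      (∑ j ∈ s, ∑ α ∈ multiIndices d j, ⨆ ξ ∈ S, ‖multiDeriv α f ξ‖ₑ).toReal := by
  obtain ⟨α, hα, h⟩ := exists_foldr_partialDeriv_eq_multiDeriv hf l
  rw [h, ← toReal_enorm]
  refine ENNReal.toReal_mono hfin.ne ?_
  calc ‖multiDeriv α f x‖ₑ ≤ ⨆ ξ ∈ S, ‖multiDeriv α f ξ‖ₑ :=
        le_iSup₂ (f := fun ξ (_ : ξ ∈ S) => ‖multiDeriv α f ξ‖ₑ) x hx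
    _ ≤ ∑ α ∈ multiIndices d l.length, ⨆ ξ ∈ S, ‖multiDeriv α f ξ‖ₑ :=
        Finset.single_le_sum (f := fun α => ⨆ ξ ∈ S, ‖multiDeriv α f ξ‖ₑ)
          (fun _ _ => zero_le) hα
    _ ≤ _ := Finset.single_le_sum
        (f := fun j => ∑ α ∈ multiIndices d j, ⨆ ξ ∈ S, ‖multiDeriv α f ξ‖ₑ)
          (fun _ _ => zero_le) hl

theorem contDiff_exp_phase {Φ : EuclideanSpace ℝ (Fin d) → ℝ} (hΦ : ContDiff ℝ ∞ Φ) (lam : ℝ) :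
    ContDiff ℝ ∞ fun x => Complex.exp (Complex.I * (lam : ℂ) * (Φ x : ℂ)) :=
  (contDiff_const.mul (Complex.ofRealCLM.contDiff.comp hΦ)).cexp

theorem partialDeriv_exp_phase {Φ : EuclideanSpace ℝ (Fin d) → ℝ} (hΦ : ContDiff ℝ ∞ Φ)
    (lam : ℝ) (j : Fin d) (x : EuclideanSpace ℝ (Fin d)) :
    partialDeriv j (fun x => Complex.exp (Complex.I * (lam : ℂ) * (Φ x : ℂ))) x =
      Complex.I * (lam * partialDeriv j Φ x : ℝ) *
        Complex.exp (Complex.I * (lam : ℂ) * (Φ x : ℂ)) := by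
  have h1 : HasFDerivAt (fun x => (Φ x : ℂ)) (Complex.ofRealCLM.comp (fderiv ℝ Φ x)) x :=
    Complex.ofRealCLM.hasFDerivAt.comp x (hΦ.differentiable (by simp) x).hasFDerivAt
  have h2 := (h1.const_mul (Complex.I * (lam : ℂ))).cexp
  unfold partialDeriv
  rw [h2.fderiv]
  simp
  ring

end MainEstimate

theorem mainTheorem2 (d : ℕ) (hd : 1 ≤ d) :
    ∃ C : ℝ, 0 < C ∧
      ∀ (Φ : EuclideanSpace ℝ (Fin d) → ℝ) (b : EuclideanSpace ℝ (Fin d) → ℂ)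
        (V : Set (EuclideanSpace ℝ (Fin d))) (a₀ lam : ℝ),
        ContDiff ℝ ∞ Φ → ContDiff ℝ ∞ b → HasCompactSupport b →
        IsOpen V → tsupport b ⊆ V →
        (∀ k : ℕ, 2 ≤ k → k ≤ d + 2 → phaseNorm Φ V k < ⊤) →
        (∀ l : ℕ, l ≤ d + 1 → symbolNorm b l < ⊤) →
        0 < a₀ → (∀ ξ ∈ V, a₀ ≤ |(hessianMatrix Φ ξ).det|) →
        Set.InjOn (gradient Φ) V →
        1 ≤ lam →
        ‖oscillatoryIntegral Φ b lam‖ ≤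
          C / a₀ * (1 + (phaseNorm Φ V (d + 2)).toReal ^ ((d : ℝ) / 2)) *
            (symbolNorm b (d + 1)).toReal * lam ^ (-((d : ℝ) / 2)) := by
  obtain ⟨C₁, hC₁, H₁⟩ := exists_norm_integral_le_integral_fieldWeight d (d + 1)
  obtain ⟨C₂, hC₂, H₂⟩ := exists_setIntegral_fieldWeight_le d
  refine ⟨C₁ * C₂, mul_pos hC₁ hC₂,
    fun Φ b V a₀ lam hΦ hb hbc _ hbV hphase hsymbol ha hdet hinj hlam => ?_⟩
  have hPfin := hphase (d + 2) (by omega) le_rfl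
  have hBfin := hsymbol (d + 1) le_rfl
  set P := (phaseNorm Φ V (d + 2)).toReal with hP
  set B := (symbolNorm b (d + 1)).toReal with hB
  have hP0 : 0 ≤ P := ENNReal.toReal_nonneg
  have hB0 : 0 ≤ B := ENNReal.toReal_nonneg
  -- Truncation at 1 ensures M⁻¹ exists and λM ≥ 1, hence ε ≤ 1.
  set M := max 1 P with hM
  have hM1 : 1 ≤ M := le_max_left _ _
  have hM0 : 0 < M := by linarith
  have hlam0 : 0 < lam := by linarith
  -- With ε = τ⁻¹, the scales are forced by ελ = σ (so ε∂ⱼe = i gⱼ e) and εσ = M⁻¹ (so ε∂ⱼgₖ is a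
  -- normalized Hessian entry).
  set σ := √(lam / M) with hσ
  set τ := √(lam * M) with hτ
  have hσ0 : 0 < σ := Real.sqrt_pos.2 (by positivity)
  have hτ0 : 0 < τ := Real.sqrt_pos.2 (by positivity)
  have hστ : σ * τ = lam := by
    rw [hσ, hτ, ← Real.sqrt_mul (by positivity), show lam / M * (lam * M) = lam ^ 2 by field_simp,
      Real.sqrt_sq hlam0.le]
  have hσM : σ * M = τ := by
    rw [hτ, show lam * M = lam / M * M ^ 2 by field_simp, Real.sqrt_mul (by positivity),
      Real.sqrt_sq hM0.le]
  have hτ1 : 1 ≤ τ := Real.one_le_sqrt.2 (one_le_mul_of_one_le_of_one_le hlam hM1)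
  have hε0 : 0 ≤ τ⁻¹ := inv_nonneg.2 hτ0.le
  have hε1 : τ⁻¹ ≤ 1 := inv_le_one_of_one_le₀ hτ1
  have hεσ : τ⁻¹ * σ = M⁻¹ := by rw [← hσM]; field_simp
  have hεlam : τ⁻¹ * lam = σ := by rw [← hστ]; field_simp
  have hd1 := contDiff_partialDeriv hΦ
  have hd2 := fun j k => contDiff_partialDeriv (hd1 k) j
  have main := H₁ τ⁻¹ B (fun k x => σ • partialDeriv k Φ x)
    (fun j k x => M⁻¹ • partialDeriv j (partialDeriv k Φ) x)
    (fun x => Complex.exp (Complex.I * (lam : ℂ) * (Φ x : ℂ))) b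
    (fun k => (hd1 k).const_smul σ) (fun j k => (hd2 j k).const_smul M⁻¹)
    (contDiff_exp_phase hΦ lam) hb hbc
    (fun j k x => by
      rw [partialDeriv_const_smul σ (hd1 k), smul_smul, hεσ])
    (fun j x => by
      rw [partialDeriv_exp_phase hΦ, ← hεlam]
      simp only [Complex.real_smul, smul_eq_mul]
      push_cast
      ring)
    (fun x => by
      rw [mul_assoc, ← Complex.ofReal_mul, mul_comm, Complex.norm_exp_ofReal_mul_I])
    (fun j k => DerivBound.of_foldr hε0 hε1 ((hd2 j k).const_smul M⁻¹) fun l hl x hx => by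
      rw [(foldr_partialDeriv_const_smul M⁻¹ (hd2 j k) l).2, norm_smul,
        Real.norm_of_nonneg (inv_nonneg.2 hM0.le), inv_mul_eq_div, div_le_one hM0]
      -- At most d derivatives of a Hessian entry give total order between 2 and d + 2, exactly the
      -- range of 𝓜_{d+2}.
      have := norm_foldr_partialDeriv_le_toReal hΦ hPfin (l ++ [j, k])
        (by simp at hl ⊢; omega) (hbV hx)
      rw [List.foldr_append] at this
      exact this.trans (le_max_right _ _))
    (DerivBound.of_foldr hε0 hε1 hb fun l hl x hx =>
      norm_foldr_partialDeriv_le_toReal hb hBfin l (by simpa using hl) hx)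
  have hcov := H₂ Φ (tsupport b) a₀ σ hΦ hbc ha hσ0 (fun ξ hξ => hdet ξ (hbV hξ))
    (hinj.mono hbV)
  have hσd : (σ ^ d)⁻¹ = M ^ ((d : ℝ) / 2) * lam ^ (-((d : ℝ) / 2)) := by
    rw [← inv_pow, hσ, ← Real.sqrt_inv, sqrt_inv_pow_eq_rpow (by positivity), neg_div,
      Real.div_rpow hlam0.le hM0.le, Real.rpow_neg hM0.le, div_inv_eq_mul, mul_comm]
  have hMP : M ^ ((d : ℝ) / 2) ≤ 1 + P ^ ((d : ℝ) / 2) := by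
    rcases max_cases 1 P with ⟨h, -⟩ | ⟨h, -⟩
    · rw [hM, h, Real.one_rpow]
      linarith [Real.rpow_nonneg hP0 ((d : ℝ) / 2)]
    · rw [hM, h]
      linarith
  calc ‖oscillatoryIntegral Φ b lam‖
      ≤ C₁ * B * (C₂ / a₀ * (σ ^ d)⁻¹) :=
        main.trans (mul_le_mul_of_nonneg_left hcov (by positivity))
    _ = C₁ * C₂ / a₀ * M ^ ((d : ℝ) / 2) * B * lam ^ (-((d : ℝ) / 2)) := by rw [hσd]; ring
    _ ≤ _ := by gcongr
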